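/- Let $d, K_0, K_1 \ge 1$ be integers, let $\pi_0=(\pi_0^k)_{k\le K_0}$ and $\pi_1=(\pi_1^k)_{k\le K_1}$ be vectors of non-negative weights, each summing to $1$, let $m_0^1,\dots,m_0^{K_0}, m_1^1,\dots,m_1^{K_1}\in\mathbb{R}^d$, and let $\Sigma_0^1,\dots,\Sigma_0^{K_0}$ be symmetric positive semidefinite real $d\times d$ matrices. Put $$\mu_0=\sum_{k=1}^{K_0}\pi_0^k\,\mathcal N(m_0^k,\Sigma_0^k),\qquad \tilde\mu_0=\sum_{k=1}^{K_0}\pi_0^k\,\delta_{m_0^k},\qquad \mu_1=\sum_{k=1}^{K_1}\pi_1^k\,\delta_{m_1^k}.$$ For probability measures $\mu,\nu$ on $\mathbb{R}^d$ let $\Pi(\mu,\nu)$ be the set of probability measures on $\mathbb{R}^d\times\mathbb{R}^d$ with marginals $\mu$ and $\nu$, let $GMM_{2d}(\infty)$ be the set of finite mixtures (convex combinations) of possibly degenerate Gaussian measures on $\mathbb{R}^d\times\mathbb{R}^d=\mathbb{R}^{2d}$, and define, with the Euclidean norm, $$W_2^2(\mu,\nu)=\inf_{\gamma\in\Pi(\mu,\nu)}\int\|x-y\|^2\,d\gamma(x,y),\qquad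 MW_2^2(\mu,\nu)=\inf_{\gamma\in\Pi(\mu,\nu)\cap GMM_{2d}(\infty)}\int\|x-y\|^2\,d\gamma(x,y).$$ Then both $W_2^2(\tilde\mu_0,\mu_1)$ and $MW_2^2(\mu_0,\mu_1)$ are finite, and $$MW_2^2(\mu_0,\mu_1)=W_2^2(\tilde\mu_0,\mu_1)+\sum_{k=1}^{K_0}\pi_0^k\,\mathrm{tr}(\Sigma_0^k).$$ -/

import Mathlib

open MeasureTheory ProbabilityTheory
open scoped ENNReal

namespace GMMTransport

/-- The finite mixture `∑ₖ πₖ νₖ` of measures with real weights `πₖ`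
(used only for `π` in the standard simplex). -/
noncomputable def mixture {E : Type*} [MeasurableSpace E] {K : ℕ}
    (π : Fin K → ℝ) (ν : Fin K → Measure E) : Measure E :=
  ∑ k, ENNReal.ofReal (π k) • ν k

/-- Finite Gaussian mixtures: convex combinations of finitely many Gaussian measures, which may be
degenerate. On a finite-dimensional space `IsGaussian` describes exactly the laws `𝒩(m, Σ)`
with `Σ` positive semidefinite. -/
def IsGaussianMixture {E : Type*} [TopologicalSpace E] [AddCommMonoid E] [Module ℝ E]
    [MeasurableSpace E] (μ : Measure E) : Prop :=
  ∃ (K : ℕ) (π : Fin K → ℝ) (ν : Fin K → Measure E),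
    π ∈ stdSimplex ℝ (Fin K) ∧ (∀ k, IsGaussian (ν k)) ∧ μ = mixture π ν

/-- The transport plans `Π(μ, ν)`: measures on the product with marginals `μ` and `ν`
(probability measures whenever `μ` is one). -/
def couplings {E : Type*} [MeasurableSpace E] (μ ν : Measure E) : Set (Measure (E × E)) :=
  {γ | γ.map Prod.fst = μ ∧ γ.map Prod.snd = ν}

/-- The quadratic cost `∫ ‖x - y‖² dγ(x, y)` of a plan, in `[0, ∞]`. -/
noncomputable def quadCost {E : Type*} [NormedAddCommGroup E] [MeasurableSpace E]
    (γ : Measure (E × E)) : ℝ≥0∞ :=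
  ∫⁻ p, ‖p.1 - p.2‖ₑ ^ 2 ∂γ

/-- The squared Wasserstein distance `W₂²`. -/
noncomputable def W2sq {E : Type*} [NormedAddCommGroup E] [MeasurableSpace E]
    (μ ν : Measure E) : ℝ≥0∞ :=
  ⨅ γ ∈ couplings μ ν, quadCost γ

/-- The squared mixture Wasserstein distance `MW₂²`: the infimum of the quadratic cost over the
plans that are finite Gaussian mixtures on the product space. -/
noncomputable def MW2sq {E : Type*} [NormedAddCommGroup E] [NormedSpace ℝ E] [MeasurableSpace E]
    (μ ν : Measure E) : ℝ≥0∞ :=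
  ⨅ γ ∈ {γ | γ ∈ couplings μ ν ∧ IsGaussianMixture γ}, quadCost γ

end GMMTransport

namespace GMMTransport

/-! Take a Gaussian mixture plan for `MW2sq`. Its second marginal is discrete, so each component of
nonzero weight has an almost surely constant second coordinate; its cost is the squared distance
between its two means plus the trace of the covariance of its first marginal. Replacing components
by Dirac masses at their means gives a discrete plan (`plan_of_means`). That its marginals are the
prescribed ones, and that the weighted traces add up to `∑ k, π₀ k * (S₀ k).trace`, follows from
identifiability of finite Gaussian mixtures along linear forms (`sum_smul_eq_of_mixture_eq`), itself
a matter of growth rates of moment generating functions. Conversely, every discrete plan arises in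
this way from a mixture of products of a Gaussian with a Dirac mass (`exists_mixture_plan`). The two
sets of costs thus differ by a constant shift, and so do their infima. -/

open Filter Asymptotics

/-! ### Linear independence of exponentials of quadratics -/

/-- Functions that are strictly ordered by their growth are linearly independent. -/
lemma linearIndependent_of_isLittleO {ι α : Type*} [LinearOrder ι] {l : Filter α} [l.NeBot]
    (f : ι → α → ℝ) (hf : ∀ i x, f i x ≠ 0) (h : ∀ i j, i < j → f i =o[l] f j) :
    LinearIndependent ℝ f := by
  classical
  rw [linearIndependent_iff']
  intro s c hs
  by_contra! hne
  obtain ⟨i₀, hi₀, hci₀⟩ := hne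
  have hT : (s.filter fun i => c i ≠ 0).Nonempty := ⟨i₀, by simp [hi₀, hci₀]⟩
  set T := s.filter fun i => c i ≠ 0
  -- The fastest-growing term with nonzero coefficient would be minus the sum of the others, hence
  -- negligible against itself.
  set m := T.max' hT
  have hm : m ∈ T := T.max'_mem hT
  have hTsum : ∑ i ∈ T, c i • f i = 0 := by
    rw [← hs, Finset.sum_filter_of_ne]
    intro i _ hi hc
    simp [hc] at hi
  have hlit : (fun x => ∑ i ∈ T.erase m, c i * f i x) =o[l] f m := by
    refine IsLittleO.fun_sum fun i hi => ?_
    refine (h i m ?_).const_mul_left (c i)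
    exact lt_of_le_of_ne (T.le_max' i (Finset.mem_of_mem_erase hi)) (Finset.ne_of_mem_erase hi)
  have hEq : (fun x => ∑ i ∈ T.erase m, c i * f i x) = fun x => (-c m) * f m x := by
    funext x
    have := congrFun hTsum x
    rw [← Finset.add_sum_erase T _ hm] at this
    simp only [Pi.add_apply, Pi.smul_apply, smul_eq_mul, Finset.sum_apply, Pi.zero_apply] at this
    linarith
  have hcm : c m ≠ 0 := (Finset.mem_filter.1 hm).2
  rw [hEq, isLittleO_const_mul_left_iff (neg_ne_zero.2 hcm)] at hlit
  exact isLittleO_irrefl (Eventually.of_forall (hf m)).frequently hlit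

/-- The moment generating functions of the real Gaussian laws are linearly independent. The index
is the pair (variance, mean), ordered lexicographically. -/
lemma linearIndependent_exp_quadratic :
    LinearIndependent ℝ (fun (p : ℝ ×ₗ ℝ) (s : ℝ) =>
      Real.exp ((ofLex p).2 * s + (ofLex p).1 * s ^ 2 / 2)) := by
  refine linearIndependent_of_isLittleO (l := atTop) _ (fun _ _ => (Real.exp_pos _).ne') ?_
  intro p q hpq
  rw [Real.isLittleO_exp_comp_exp_comp]
  rcases Prod.Lex.lt_iff.1 hpq with h | ⟨h1, h2⟩
  · have h1 : Tendsto (fun s : ℝ => s * (((ofLex q).2 - (ofLex p).2) +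
        (((ofLex q).1 - (ofLex p).1) / 2) * s)) atTop atTop := by
      refine tendsto_id.atTop_mul_atTop₀ ?_
      exact tendsto_atTop_add_const_left _ _ (tendsto_id.const_mul_atTop (by linarith))
    refine h1.congr fun s => ?_
    ring
  · have h3 : Tendsto (fun s : ℝ => ((ofLex q).2 - (ofLex p).2) * s) atTop atTop :=
      tendsto_id.const_mul_atTop (by linarith)
    refine h3.congr fun s => ?_
    simp only [h1]
    ring

/-- A finite combination of exponentials `exp (a s + b s² / 2)` determines the signed measure
carried by the pairs `(a, b)`. -/
lemma sum_smul_eq_of_sum_exp_eq {ι κ V : Type*} [Fintype ι] [Fintype κ] [AddCommGroup V]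
    [Module ℝ V] {c a b : ι → ℝ} {c' a' b' : κ → ℝ}
    (h : ∀ s : ℝ, ∑ i, c i * Real.exp (a i * s + b i * s ^ 2 / 2) =
      ∑ j, c' j * Real.exp (a' j * s + b' j * s ^ 2 / 2)) (φ : ℝ → ℝ → V) :
    ∑ i, c i • φ (a i) (b i) = ∑ j, c' j • φ (a' j) (b' j) := by
  -- As finitely supported functions, `F` and `G` add up the coefficients of repeated pairs, so the
  -- families need not be injective.
  set F : (ℝ ×ₗ ℝ) →₀ ℝ := ∑ i, Finsupp.single (toLex (b i, a i)) (c i)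
  set G : (ℝ ×ₗ ℝ) →₀ ℝ := ∑ j, Finsupp.single (toLex (b' j, a' j)) (c' j)
  have hFG : F = G := by
    refine linearIndependent_exp_quadratic ?_
    funext s
    simpa [F, G, map_sum, Finsupp.linearCombination_single] using h s
  have := congrArg (Finsupp.linearCombination ℝ
    fun p : ℝ ×ₗ ℝ => φ (ofLex p).2 (ofLex p).1) hFG
  simpa [F, G, map_sum, Finsupp.linearCombination_single] using this

/-! ### Identifiability of finite Gaussian mixtures -/

section Mixture

variable {E : Type*} [MeasurableSpace E]

lemma lintegral_mixture {K : ℕ} (π : Fin K → ℝ) (ν : Fin K → Measure E) (f : E → ℝ≥0∞) :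
    ∫⁻ x, f x ∂(mixture π ν) = ∑ k, ENNReal.ofReal (π k) * ∫⁻ x, f x ∂(ν k) := by
  simp [mixture, lintegral_smul_measure]

lemma map_mixture {F : Type*} [MeasurableSpace F] {K : ℕ} (π : Fin K → ℝ) (ν : Fin K → Measure E)
    {f : E → F} (hf : Measurable f) :
    (mixture π ν).map f = mixture π fun k => (ν k).map f := by
  ext s hs
  simp [mixture, Measure.map_apply hf hs]

lemma isProbabilityMeasure_mixture {K : ℕ} {π : Fin K → ℝ} (hπ : π ∈ stdSimplex ℝ (Fin K))
    (ν : Fin K → Measure E) [∀ k, IsProbabilityMeasure (ν k)] :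
    IsProbabilityMeasure (mixture π ν) := by
  constructor
  simp [mixture, ← ENNReal.ofReal_sum_of_nonneg fun k _ => hπ.1 k, hπ.2]

section Normed

variable [NormedAddCommGroup E] [NormedSpace ℝ E] [BorelSpace E]

lemma lintegral_exp_dual (ν : Measure E) [IsGaussian ν] (L : StrongDual ℝ E) (s : ℝ) :
    ∫⁻ x, ENNReal.ofReal (Real.exp (s * L x)) ∂ν =
      ENNReal.ofReal (Real.exp (ν[L] * s + Var[L; ν] * s ^ 2 / 2)) := by
  have hmap := IsGaussian.map_eq_gaussianReal (μ := ν) L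
  have h1 : ∫⁻ x, ENNReal.ofReal (Real.exp (s * L x)) ∂ν =
      ∫⁻ y, ENNReal.ofReal (Real.exp (s * y)) ∂(ν.map L) := by
    rw [lintegral_map (by fun_prop) (by fun_prop)]
  rw [h1, hmap, ← ofReal_integral_eq_lintegral_ofReal]
  · have := congrFun (mgf_id_gaussianReal (μ := ν[L]) (v := Var[L; ν].toNNReal)) s
    simp only [mgf, id, Real.coe_toNNReal _ (variance_nonneg _ _)] at this
    rw [this]
  · exact integrable_exp_mul_gaussianReal s
  · exact Eventually.of_forall fun _ => (Real.exp_pos _).le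

/-- **Identifiability of finite Gaussian mixtures**, along a linear form `L`: the mixture determines
the weighted sums of all functions of the means and variances of `L`. -/
lemma sum_smul_eq_of_mixture_eq {K K' : ℕ} {V : Type*} [AddCommGroup V] [Module ℝ V]
    {π : Fin K → ℝ} (hπ : ∀ k, 0 ≤ π k) {ν : Fin K → Measure E} [∀ k, IsGaussian (ν k)]
    {π' : Fin K' → ℝ} (hπ' : ∀ k, 0 ≤ π' k) {ν' : Fin K' → Measure E} [∀ k, IsGaussian (ν' k)]
    (h : mixture π ν = mixture π' ν') (L : StrongDual ℝ E) (φ : ℝ → ℝ → V) :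
    ∑ k, π k • φ (ν k)[L] Var[L; ν k] = ∑ k, π' k • φ (ν' k)[L] Var[L; ν' k] := by
  refine sum_smul_eq_of_sum_exp_eq (fun s => ?_) φ
  have key : ∀ {J : ℕ} {p : Fin J → ℝ} (_ : ∀ k, 0 ≤ p k) (η : Fin J → Measure E)
      [∀ k, IsGaussian (η k)],
      ∫⁻ x, ENNReal.ofReal (Real.exp (s * L x)) ∂(mixture p η) =
        ENNReal.ofReal (∑ k, p k * Real.exp ((η k)[L] * s + Var[L; η k] * s ^ 2 / 2)) := by
    intro J p hp η _
    rw [lintegral_mixture, ENNReal.ofReal_sum_of_nonneg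
      fun k _ => mul_nonneg (hp k) (Real.exp_pos _).le]
    simp_rw [lintegral_exp_dual, ENNReal.ofReal_mul (hp _)]
  have h2 := (key hπ ν).symm.trans (h ▸ key hπ' ν')
  rwa [ENNReal.ofReal_eq_ofReal_iff] at h2
  · exact Finset.sum_nonneg fun k _ => mul_nonneg (hπ k) (Real.exp_pos _).le
  · exact Finset.sum_nonneg fun k _ => mul_nonneg (hπ' k) (Real.exp_pos _).le

lemma charFunDual_mixture_dirac {K : ℕ} {π : Fin K → ℝ} (hπ : ∀ k, 0 ≤ π k) (m : Fin K → E)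
    (L : StrongDual ℝ E) :
    charFunDual (mixture π fun k => Measure.dirac (m k)) L =
      ∑ k, π k • Complex.exp (L (m k) * Complex.I) := by
  rw [charFunDual_apply, mixture, integral_finsetSum_measure]
  · refine Finset.sum_congr rfl fun k _ => ?_
    rw [integral_smul_measure, integral_dirac' _ _ (by fun_prop), ENNReal.toReal_ofReal (hπ k)]
  · intro k _
    exact (integrable_dirac' (by fun_prop) (by simp)).smul_measure ENNReal.ofReal_ne_top

variable [CompleteSpace E] [SecondCountableTopology E]

/-- A finite Gaussian mixture determines the distribution of the means of its components. -/
lemma mixture_dirac_mean_eq {K K' : ℕ}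
    {π : Fin K → ℝ} (hπ : π ∈ stdSimplex ℝ (Fin K)) {ν : Fin K → Measure E}
    [∀ k, IsGaussian (ν k)]
    {π' : Fin K' → ℝ} (hπ' : π' ∈ stdSimplex ℝ (Fin K')) {ν' : Fin K' → Measure E}
    [∀ k, IsGaussian (ν' k)] (h : mixture π ν = mixture π' ν') :
    mixture π (fun k => Measure.dirac (∫ x, x ∂(ν k))) =
      mixture π' fun k => Measure.dirac (∫ x, x ∂(ν' k)) := by
  have := isProbabilityMeasure_mixture hπ (fun k => Measure.dirac (∫ x, x ∂(ν k)))
  have := isProbabilityMeasure_mixture hπ' (fun k => Measure.dirac (∫ x, x ∂(ν' k)))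
  refine Measure.ext_of_charFunDual (funext fun L => ?_)
  rw [charFunDual_mixture_dirac hπ.1, charFunDual_mixture_dirac hπ'.1]
  have := sum_smul_eq_of_mixture_eq hπ.1 hπ'.1 h L fun a _ => Complex.exp (a * Complex.I)
  simpa only [IsGaussian.integral_dual] using this

end Normed

end Mixture


/-! ### Plans between finitely supported measures -/

section Discrete

variable {E : Type*} [MeasurableSpace E]

lemma mixture_apply {K : ℕ} (π : Fin K → ℝ) (ν : Fin K → Measure E) (s : Set E) :
    mixture π ν s = ∑ k, ENNReal.ofReal (π k) * ν k s := by
  simp [mixture]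

lemma mixture_dirac_singleton_ne_top {K : ℕ} (π : Fin K → ℝ) (m : Fin K → E) (x : E) :
    mixture π (fun j => Measure.dirac (m j)) {x} ≠ ∞ := by
  rw [mixture_apply]
  exact ENNReal.sum_ne_top.2 fun k _ => ENNReal.mul_ne_top ENNReal.ofReal_ne_top (measure_ne_top _ _)

variable [MeasurableSingletonClass E]

/-- The density of the `k`-th component of a discrete measure `∑ₖ πₖ δ_{mₖ}` with respect to the
whole measure. -/
noncomputable def componentDensity {K : ℕ} (π : Fin K → ℝ) (m : Fin K → E) (k : Fin K) : E → ℝ≥0∞ :=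
  Set.indicator {m k} fun _ =>
    ENNReal.ofReal (π k) / mixture π (fun j => Measure.dirac (m j)) {m k}

lemma measurable_componentDensity {K : ℕ} (π : Fin K → ℝ) (m : Fin K → E) (k : Fin K) :
    Measurable (componentDensity π m k) :=
  measurable_const.indicator (measurableSet_singleton _)

lemma le_mixture_dirac_singleton {K : ℕ} (π : Fin K → ℝ) (m : Fin K → E) (k : Fin K) :
    ENNReal.ofReal (π k) ≤ mixture π (fun j => Measure.dirac (m j)) {m k} := by
  rw [mixture_apply]
  refine le_trans ?_ (Finset.single_le_sum (fun _ _ => zero_le) (Finset.mem_univ k))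
  simp

lemma lintegral_componentDensity {K : ℕ} (π : Fin K → ℝ) (m : Fin K → E) (k : Fin K) :
    ∫⁻ x, componentDensity π m k x ∂(mixture π fun j => Measure.dirac (m j)) =
      ENNReal.ofReal (π k) := by
  rw [componentDensity, lintegral_indicator_const (measurableSet_singleton _)]
  -- A zero denominator forces a zero numerator, since the atom carries at least the mass `π k`.
  refine ENNReal.div_mul_cancel' (fun h => ?_)
    fun h => (mixture_dirac_singleton_ne_top π m _ h).elim
  exact le_antisymm (h ▸ le_mixture_dirac_singleton π m k) zero_le

/-- At `x` the densities sum to `μ {x} / μ {x}`, which is `1` at every atom of positive mass. They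
thus form a partition of unity that shares a repeated atom in proportion to the weights. -/
lemma sum_componentDensity {K : ℕ} (π : Fin K → ℝ) (m : Fin K → E) :
    ∀ᵐ x ∂(mixture π fun j => Measure.dirac (m j)), ∑ k, componentDensity π m k x = 1 := by
  classical
  set μ := mixture π fun j => Measure.dirac (m j) with hμ
  have hsum : ∀ x, ∑ k, componentDensity π m k x = μ {x} / μ {x} := by
    intro x
    have h1 : μ {x} = ∑ k, ENNReal.ofReal (π k) * Measure.dirac (m k) {x} := mixture_apply _ _ _
    conv_rhs => rw [div_eq_mul_inv]; enter [1]; rw [h1]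
    rw [Finset.sum_mul]
    refine Finset.sum_congr rfl fun k _ => ?_
    by_cases hk : m k = x
    · subst hk
      simp [componentDensity, div_eq_mul_inv, hμ]
    · simp [componentDensity, hk, Ne.symm hk]
  rw [ae_iff, hμ, mixture_apply]
  refine Finset.sum_eq_zero fun k _ => ?_
  by_cases hk : ENNReal.ofReal (π k) = 0
  · simp [hk]
  · have h0 : μ {m k} ≠ 0 := fun h =>
      hk (le_antisymm (h ▸ le_mixture_dirac_singleton π m k) zero_le)
    have hnot : m k ∉ {x | ¬ ∑ k, componentDensity π m k x = 1} := by
      simp only [Set.mem_ofPred_eq, not_not, hsum]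
      exact ENNReal.div_self h0 (mixture_dirac_singleton_ne_top π m _)
    have hmeas : MeasurableSet {x | ¬ ∑ k, componentDensity π m k x = 1} :=
      (measurableSet_eq_fun (Finset.measurable_fun_sum _ fun k _ => measurable_componentDensity π m k)
        measurable_const).compl
    rw [Measure.dirac_apply' _ hmeas, Set.indicator_of_notMem hnot, mul_zero]

/-- A plan between two finitely supported measures splits along the given atoms, also when some of
these coincide. -/
lemma exists_weights_of_mem_couplings {K₀ K₁ : ℕ} {π₀ : Fin K₀ → ℝ} {π₁ : Fin K₁ → ℝ}
    {m₀ : Fin K₀ → E} {m₁ : Fin K₁ → E} {γ : Measure (E × E)}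
    (hγ : γ ∈ couplings (mixture π₀ fun k => Measure.dirac (m₀ k))
      (mixture π₁ fun k => Measure.dirac (m₁ k))) :
    ∃ w : Fin K₀ → Fin K₁ → ℝ≥0∞,
      γ = ∑ k, ∑ l, w k l • Measure.dirac (m₀ k, m₁ l) ∧
      (∀ k, ∑ l, w k l = ENNReal.ofReal (π₀ k)) ∧ ∀ l, ∑ k, w k l = ENNReal.ofReal (π₁ l) := by
  set g := componentDensity π₀ m₀
  set h := componentDensity π₁ m₁
  have hg : ∀ k, Measurable (g k) := measurable_componentDensity π₀ m₀
  have hh : ∀ k, Measurable (h k) := measurable_componentDensity π₁ m₁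
  have hgγ : ∀ᵐ p ∂γ, ∑ k, g k p.1 = 1 :=
    ae_of_ae_map measurable_fst.aemeasurable (hγ.1 ▸ sum_componentDensity π₀ m₀)
  have hhγ : ∀ᵐ p ∂γ, ∑ k, h k p.2 = 1 :=
    ae_of_ae_map measurable_snd.aemeasurable (hγ.2 ▸ sum_componentDensity π₁ m₁)
  have hgh : ∀ k l, Measurable fun p : E × E => g k p.1 * h l p.2 := fun k l =>
    ((hg k).comp measurable_fst).mul ((hh l).comp measurable_snd)
  -- The weight is the share of `γ` given to the pair `(k, l)` by the two partitions of unity.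
  refine ⟨fun k l => ∫⁻ p, g k p.1 * h l p.2 ∂γ, ?_, fun k => ?_, fun l => ?_⟩
  · ext s hs
    have h1 : γ s = ∫⁻ p, ∑ k, ∑ l, g k p.1 * h l p.2 * s.indicator 1 (m₀ k, m₁ l) ∂γ := by
      rw [← lintegral_indicator_one hs]
      refine lintegral_congr_ae ?_
      filter_upwards [hgγ, hhγ] with p hp hp'
      have h2 : ∀ k l, g k p.1 * h l p.2 * s.indicator 1 (m₀ k, m₁ l) =
          g k p.1 * h l p.2 * s.indicator 1 p := by
        intro k l
        by_cases hk : p.1 = m₀ k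
        · by_cases hl : p.2 = m₁ l
          · rw [← hk, ← hl]
          · simp [h, componentDensity, hl]
        · simp [g, componentDensity, hk]
      simp_rw [h2, ← Finset.sum_mul, ← Finset.mul_sum, hp', mul_one, hp, one_mul]
    rw [h1, lintegral_finsetSum _ fun k _ =>
      Finset.measurable_fun_sum _ fun l _ => (hgh k l).mul_const _]
    simp_rw [lintegral_finsetSum _ fun l _ => (hgh _ l).mul_const _,
      lintegral_mul_const _ (hgh _ _)]
    simp [Measure.dirac_apply' _ hs]
  · rw [← lintegral_finsetSum _ fun l _ => hgh k l, ← lintegral_componentDensity π₀ m₀ k, ← hγ.1,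
      lintegral_map (hg k) measurable_fst]
    refine lintegral_congr_ae ?_
    filter_upwards [hhγ] with p hp
    rw [← Finset.mul_sum, hp, mul_one]
  · rw [← lintegral_finsetSum _ fun k _ => hgh k l, ← lintegral_componentDensity π₁ m₁ l, ← hγ.2,
      lintegral_map (hh l) measurable_snd]
    refine lintegral_congr_ae ?_
    filter_upwards [hgγ] with p hp
    rw [← Finset.sum_mul, hp, one_mul]

end Discrete

lemma quadCost_mixture {E : Type*} [NormedAddCommGroup E] [MeasurableSpace E] {K : ℕ}
    (π : Fin K → ℝ) (ν : Fin K → Measure (E × E)) :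
    quadCost (mixture π ν) = ∑ k, ENNReal.ofReal (π k) * quadCost (ν k) :=
  lintegral_mixture _ _ _

/-! ### Costs of plans and passage between Gaussian and discrete plans -/

section Euclidean

variable {d : ℕ}

local notation "𝔼" => EuclideanSpace ℝ (Fin d)

lemma quadCost_dirac (x y : 𝔼) :
    quadCost (Measure.dirac (x, y)) = ENNReal.ofReal (‖x - y‖ ^ 2) := by
  rw [quadCost, lintegral_dirac, ENNReal.ofReal_pow (norm_nonneg _), ofReal_norm]

/-- The product plan has finite cost, being a finite sum. -/
lemma W2sq_mixture_dirac_ne_top {K₀ K₁ : ℕ}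
    {π₀ : Fin K₀ → ℝ} (hπ₀ : π₀ ∈ stdSimplex ℝ (Fin K₀))
    {π₁ : Fin K₁ → ℝ} (hπ₁ : π₁ ∈ stdSimplex ℝ (Fin K₁)) (m₀ : Fin K₀ → 𝔼) (m₁ : Fin K₁ → 𝔼) :
    W2sq (mixture π₀ fun k => Measure.dirac (m₀ k))
      (mixture π₁ fun k => Measure.dirac (m₁ k)) ≠ ∞ := by
  have := isProbabilityMeasure_mixture hπ₀ fun k => Measure.dirac (m₀ k)
  have := isProbabilityMeasure_mixture hπ₁ fun k => Measure.dirac (m₁ k)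
  refine ne_top_of_le_ne_top ?_ (iInf₂_le ((mixture π₀ fun k => Measure.dirac (m₀ k)).prod
    (mixture π₁ fun k => Measure.dirac (m₁ k))) ⟨by simp, by simp⟩)
  rw [quadCost, lintegral_prod _ (by fun_prop), lintegral_mixture]
  simp_rw [lintegral_dirac, lintegral_mixture, lintegral_dirac]
  refine ENNReal.sum_ne_top.2 fun k _ => ENNReal.mul_ne_top ENNReal.ofReal_ne_top ?_
  exact ENNReal.sum_ne_top.2 fun k _ => ENNReal.mul_ne_top ENNReal.ofReal_ne_top (by simp)

/-- The quadratic cost of a Gaussian plan whose second marginal is degenerate. -/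
lemma quadCost_of_isGaussian (ν : Measure (𝔼 × 𝔼)) [IsGaussian ν]
    (h : ∀ i, Var[EuclideanSpace.proj i; ν.map Prod.snd] = 0) :
    quadCost ν = ENNReal.ofReal (‖(∫ x, x ∂(ν.map Prod.fst)) - ∫ y, y ∂(ν.map Prod.snd)‖ ^ 2) +
      ENNReal.ofReal (∑ i, Var[EuclideanSpace.proj i; ν.map Prod.fst]) := by
  let X : Fin d → StrongDual ℝ (𝔼 × 𝔼) := fun i =>
    (EuclideanSpace.proj i).comp (ContinuousLinearMap.fst ℝ 𝔼 𝔼)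
  let Y : Fin d → StrongDual ℝ (𝔼 × 𝔼) := fun i =>
    (EuclideanSpace.proj i).comp (ContinuousLinearMap.snd ℝ 𝔼 𝔼)
  have hY0 : ∀ i, Var[Y i; ν] = 0 := fun i => by
    rw [← h i, variance_map (by fun_prop) (by fun_prop)]; rfl
  have hX0 : ∀ i, Var[X i; ν] = Var[EuclideanSpace.proj i; ν.map Prod.fst] := fun i => by
    rw [variance_map (by fun_prop) (by fun_prop)]; rfl
  have hL : ∀ L : StrongDual ℝ (𝔼 × 𝔼), MemLp L 2 ν := fun L =>
    IsGaussian.memLp_dual ν L 2 (by simp)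
  -- `Y i` is almost surely constant, so subtracting it leaves the variance unchanged.
  have hvar : ∀ i, Var[X i - Y i; ν] = Var[X i; ν] := by
    intro i
    rw [← variance_sub_const (X := X i) (hL (X i)).aestronglyMeasurable (ν[Y i])]
    refine variance_congr ?_
    filter_upwards [ae_eq_integral_of_variance_eq_zero (hL (Y i)) (hY0 i)] with p hp
    simp [hp]
  have hint : Integrable (fun p : 𝔼 × 𝔼 => p) ν := IsGaussian.integrable_fun_id
  have hfst : ∫ x, x ∂(ν.map Prod.fst) = (∫ p, p ∂ν).1 := by
    rw [integral_map (by fun_prop) (by fun_prop)]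
    exact ((ContinuousLinearMap.fst ℝ 𝔼 𝔼).integral_comp_comm hint)
  have hsnd : ∫ x, x ∂(ν.map Prod.snd) = (∫ p, p ∂ν).2 := by
    rw [integral_map (by fun_prop) (by fun_prop)]
    exact ((ContinuousLinearMap.snd ℝ 𝔼 𝔼).integral_comp_comm hint)
  have hsq : ∀ i, ∫ p, ((X i - Y i) p) ^ 2 ∂ν =
      Var[EuclideanSpace.proj i; ν.map Prod.fst] + ((X i - Y i) (∫ p, p ∂ν)) ^ 2 := by
    intro i
    have := variance_eq_sub (hL (X i - Y i))
    rw [IsGaussian.integral_dual] at this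
    have h2 := hvar i
    rw [this, hX0] at h2
    rw [← h2]
    simp
  have hnorm : ∀ p : 𝔼 × 𝔼, ‖p.1 - p.2‖ ^ 2 = ∑ i, ((X i - Y i) p) ^ 2 := by
    intro p
    rw [EuclideanSpace.real_norm_sq_eq]
    simp [X, Y]
  have hcost : quadCost ν = ENNReal.ofReal (∫ p, ∑ i, ((X i - Y i) p) ^ 2 ∂ν) := by
    rw [ofReal_integral_eq_lintegral_ofReal
      (integrable_finsetSum _ fun i _ => (hL (X i - Y i)).integrable_sq)
      (Filter.Eventually.of_forall fun p => Finset.sum_nonneg fun i _ => sq_nonneg _)]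
    simp_rw [← hnorm, ENNReal.ofReal_pow (norm_nonneg _), ofReal_norm]
    rfl
  rw [hcost, integral_finsetSum _ fun i _ => (hL (X i - Y i)).integrable_sq]
  simp_rw [hsq]
  rw [Finset.sum_add_distrib, ← hnorm, hfst, hsnd, add_comm, ENNReal.ofReal_add (sq_nonneg _)]
  exact Finset.sum_nonneg fun i _ => variance_nonneg _ _

/-- Moving the components of a Gaussian mixture plan to their means turns a plan between a Gaussian
mixture and a discrete measure into one between discrete measures, and lowers the cost by exactly
the mean trace of the covariances. -/
lemma plan_of_means {K₀ K₁ K : ℕ}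
    {π₀ : Fin K₀ → ℝ} (hπ₀ : π₀ ∈ stdSimplex ℝ (Fin K₀))
    {π₁ : Fin K₁ → ℝ} (hπ₁ : π₁ ∈ stdSimplex ℝ (Fin K₁))
    (m₀ : Fin K₀ → 𝔼) {S₀ : Fin K₀ → Matrix (Fin d) (Fin d) ℝ} (hS₀ : ∀ k, (S₀ k).PosSemidef)
    (m₁ : Fin K₁ → 𝔼) {π : Fin K → ℝ} (hπ : π ∈ stdSimplex ℝ (Fin K))
    {ν : Fin K → Measure (𝔼 × 𝔼)} [∀ k, IsGaussian (ν k)]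
    (hγ : mixture π ν ∈ couplings (mixture π₀ fun k => multivariateGaussian (m₀ k) (S₀ k))
      (mixture π₁ fun k => Measure.dirac (m₁ k))) :
    let γ := mixture π fun k =>
      Measure.dirac (∫ x, x ∂((ν k).map Prod.fst), ∫ y, y ∂((ν k).map Prod.snd))
    γ ∈ couplings (mixture π₀ fun k => Measure.dirac (m₀ k))
        (mixture π₁ fun k => Measure.dirac (m₁ k)) ∧
      quadCost (mixture π ν) = quadCost γ + ENNReal.ofReal (∑ k, π₀ k * (S₀ k).trace) := by
  have hfst := hγ.1
  have hsnd := hγ.2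
  rw [map_mixture _ _ measurable_fst] at hfst
  rw [map_mixture _ _ measurable_snd] at hsnd
  have : ∀ k, IsGaussian ((ν k).map Prod.fst) := fun k =>
    isGaussian_map (ContinuousLinearMap.fst ℝ 𝔼 𝔼)
  have : ∀ k, IsGaussian ((ν k).map Prod.snd) := fun k =>
    isGaussian_map (ContinuousLinearMap.snd ℝ 𝔼 𝔼)
  -- Identifiability with `φ` the variance: a weighted sum of nonnegative variances vanishes, which
  -- says nothing about components of weight zero.
  have hvar : ∀ k, π k ≠ 0 → ∀ i, Var[EuclideanSpace.proj i; (ν k).map Prod.snd] = 0 := by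
    intro k hk i
    have := sum_smul_eq_of_mixture_eq hπ.1 hπ₁.1 hsnd (EuclideanSpace.proj i) fun _ b => b
    simp only [variance_dirac, smul_eq_mul, mul_zero, Finset.sum_const_zero] at this
    rw [Finset.sum_eq_zero_iff_of_nonneg
      fun k _ => mul_nonneg (hπ.1 k) (variance_nonneg _ _)] at this
    exact (mul_eq_zero.1 (this k (Finset.mem_univ k))).resolve_left hk
  have htrace : ∑ k, π k * ∑ i, Var[EuclideanSpace.proj i; (ν k).map Prod.fst] =
      ∑ k, π₀ k * (S₀ k).trace := by
    simp_rw [Matrix.trace, Finset.mul_sum]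
    rw [Finset.sum_comm, Finset.sum_comm (s := Finset.univ (α := Fin K₀))]
    refine Finset.sum_congr rfl fun i _ => ?_
    refine (sum_smul_eq_of_mixture_eq hπ.1 hπ₀.1 hfst (EuclideanSpace.proj i) fun _ b => b).trans ?_
    refine Finset.sum_congr rfl fun k _ => ?_
    rw [smul_eq_mul, EuclideanSpace.coe_proj, variance_eval_multivariateGaussian (hS₀ k)]
    rfl
  refine ⟨⟨?_, ?_⟩, ?_⟩
  · rw [map_mixture _ _ measurable_fst]
    simpa [Measure.map_dirac' measurable_fst] using mixture_dirac_mean_eq hπ hπ₀ hfst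
  · rw [map_mixture _ _ measurable_snd]
    simpa [Measure.map_dirac' measurable_snd] using mixture_dirac_mean_eq hπ hπ₁ hsnd
  · have hterm : ∀ k, 0 ≤ π k * ∑ i, Var[EuclideanSpace.proj i; (ν k).map Prod.fst] := fun k =>
      mul_nonneg (hπ.1 k) (Finset.sum_nonneg fun i _ => variance_nonneg _ _)
    rw [quadCost_mixture, quadCost_mixture, ← htrace,
      ENNReal.ofReal_sum_of_nonneg fun k _ => hterm k, ← Finset.sum_add_distrib]
    refine Finset.sum_congr rfl fun k _ => ?_
    rw [ENNReal.ofReal_mul (hπ.1 k), ← mul_add, quadCost_dirac]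
    by_cases hk : π k = 0
    · simp [hk]
    · rw [quadCost_of_isGaussian (ν k) (hvar k hk)]

/-- Every plan between the discrete measures is the plan of means of some Gaussian mixture plan. -/
lemma exists_mixture_plan {K₀ K₁ : ℕ}
    {π₀ : Fin K₀ → ℝ} (hπ₀ : π₀ ∈ stdSimplex ℝ (Fin K₀))
    {π₁ : Fin K₁ → ℝ} (hπ₁ : π₁ ∈ stdSimplex ℝ (Fin K₁))
    (m₀ : Fin K₀ → 𝔼) {S₀ : Fin K₀ → Matrix (Fin d) (Fin d) ℝ} (hS₀ : ∀ k, (S₀ k).PosSemidef)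
    (m₁ : Fin K₁ → 𝔼) {γ : Measure (𝔼 × 𝔼)}
    (hγ : γ ∈ couplings (mixture π₀ fun k => Measure.dirac (m₀ k))
      (mixture π₁ fun k => Measure.dirac (m₁ k))) :
    ∃ γ' ∈ couplings (mixture π₀ fun k => multivariateGaussian (m₀ k) (S₀ k))
        (mixture π₁ fun k => Measure.dirac (m₁ k)), IsGaussianMixture γ' ∧
      quadCost γ' = quadCost γ + ENNReal.ofReal (∑ k, π₀ k * (S₀ k).trace) := by
  obtain ⟨w, hw, hw₀, hw₁⟩ := exists_weights_of_mem_couplings hγ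
  have hwtop : ∀ k l, w k l ≠ ∞ := fun k l =>
    ENNReal.sum_ne_top.1 (hw₀ k ▸ ENNReal.ofReal_ne_top) l (Finset.mem_univ l)
  let e : Fin (K₀ * K₁) ≃ Fin K₀ × Fin K₁ := finProdFinEquiv.symm
  let π : Fin (K₀ * K₁) → ℝ := fun j => (w (e j).1 (e j).2).toReal
  have hmix : ∀ {F : Type} [MeasurableSpace F] (η : Fin K₀ → Fin K₁ → Measure F),
      mixture π (fun j => η (e j).1 (e j).2) = ∑ k, ∑ l, w k l • η k l := by
    intro F _ η
    rw [← Fintype.sum_prod_type' fun k l => w k l • η k l, ← e.sum_comp]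
    simp [mixture, π, ENNReal.ofReal_toReal (hwtop _ _)]
  have hπ : π ∈ stdSimplex ℝ (Fin (K₀ * K₁)) := by
    refine ⟨fun j => ENNReal.toReal_nonneg, ?_⟩
    rw [e.sum_comp (fun q => (w q.1 q.2).toReal), Fintype.sum_prod_type, ← hπ₀.2]
    refine Finset.sum_congr rfl fun k _ => ?_
    rw [← ENNReal.toReal_sum fun l _ => hwtop k l, hw₀, ENNReal.toReal_ofReal (hπ₀.1 k)]
  let ν : Fin (K₀ * K₁) → Measure (𝔼 × 𝔼) := fun j =>
    (multivariateGaussian (m₀ (e j).1) (S₀ (e j).1)).prod (Measure.dirac (m₁ (e j).2))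
  have hν : ∀ j, IsGaussian (ν j) := fun j => by dsimp only [ν]; infer_instance
  have hfst : ∀ j, (ν j).map Prod.fst = multivariateGaussian (m₀ (e j).1) (S₀ (e j).1) :=
    fun j => by simp [ν]
  have hsnd : ∀ j, (ν j).map Prod.snd = Measure.dirac (m₁ (e j).2) := fun j => by simp [ν]
  have hcoup : mixture π ν ∈ couplings
      (mixture π₀ fun k => multivariateGaussian (m₀ k) (S₀ k))
      (mixture π₁ fun k => Measure.dirac (m₁ k)) := by
    constructor
    · rw [map_mixture _ _ measurable_fst]
      simp_rw [hfst]
      rw [hmix fun k _ => multivariateGaussian (m₀ k) (S₀ k), mixture]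
      simp_rw [← Finset.sum_smul, hw₀]
    · rw [map_mixture _ _ measurable_snd]
      simp_rw [hsnd]
      rw [hmix fun _ l => Measure.dirac (m₁ l), mixture, Finset.sum_comm]
      simp_rw [← Finset.sum_smul, hw₁]
  refine ⟨mixture π ν, hcoup, ⟨_, π, ν, hπ, hν, rfl⟩, ?_⟩
  -- The plan of means of this mixture is `γ` itself.
  rw [(plan_of_means hπ₀ hπ₁ m₀ hS₀ m₁ hπ hcoup).2]
  simp_rw [hfst, hsnd, integral_id_multivariateGaussian, integral_dirac]
  rw [hmix fun k l => Measure.dirac (m₀ k, m₁ l), ← hw]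

end Euclidean

end GMMTransport

theorem mainTheorem9 {d K₀ K₁ : ℕ}
    (π₀ : Fin K₀ → ℝ) (hπ₀ : π₀ ∈ stdSimplex ℝ (Fin K₀))
    (π₁ : Fin K₁ → ℝ) (hπ₁ : π₁ ∈ stdSimplex ℝ (Fin K₁))
    (m₀ : Fin K₀ → EuclideanSpace ℝ (Fin d))
    (S₀ : Fin K₀ → Matrix (Fin d) (Fin d) ℝ) (hS₀ : ∀ k, (S₀ k).PosSemidef)
    (m₁ : Fin K₁ → EuclideanSpace ℝ (Fin d)) :
    GMMTransport.W2sq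
        (GMMTransport.mixture π₀ fun k => Measure.dirac (m₀ k))
        (GMMTransport.mixture π₁ fun k => Measure.dirac (m₁ k)) ≠ ∞ ∧
    GMMTransport.MW2sq
        (GMMTransport.mixture π₀ fun k => multivariateGaussian (m₀ k) (S₀ k))
        (GMMTransport.mixture π₁ fun k => Measure.dirac (m₁ k)) =
      GMMTransport.W2sq
          (GMMTransport.mixture π₀ fun k => Measure.dirac (m₀ k))
          (GMMTransport.mixture π₁ fun k => Measure.dirac (m₁ k)) +
        ENNReal.ofReal (∑ k, π₀ k * (S₀ k).trace) := by
  refine ⟨GMMTransport.W2sq_mixture_dirac_ne_top hπ₀ hπ₁ m₀ m₁, le_antisymm ?_ ?_⟩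
  · rw [GMMTransport.W2sq, ENNReal.iInf₂_add]
    refine le_iInf₂ fun γ hγ => ?_
    obtain ⟨γ', hγ', hmix, hcost⟩ := GMMTransport.exists_mixture_plan hπ₀ hπ₁ m₀ hS₀ m₁ hγ
    exact hcost ▸ iInf₂_le γ' ⟨hγ', hmix⟩
  · refine le_iInf₂ fun γ hγ => ?_
    obtain ⟨hcoup, K, π, ν, hπ, hν, rfl⟩ := hγ
    obtain ⟨h1, h2⟩ := GMMTransport.plan_of_means hπ₀ hπ₁ m₀ hS₀ m₁ hπ hcoup
    rw [h2]
    gcongr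
    exact iInf₂_le _ h1
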